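/- **Setting.** Let $\mathcal Q$ be an $[[n,k]]$ CSS code with full-rank check matrices $\mathsf H_X,\mathsf H_Z$ and logical operators $\bar X_i,\bar Z_i$, which corrects every Pauli error on at most $t$ qubits. Consider ancilla blocks of $\mathcal Q$ in which every logical qubit is in $|0\rangle$ (stabilized by $\bar Z_i$) or in $|+\rangle$ (stabilized by $\bar X_i$), in particular $|0\rangle_L^{\otimes k}$ and $|+\rangle_L^{\otimes k}$. Fix an error type $\mu\in\{X,Z\}$. Let $S_\mu$ be the generators of the stabilizer group of the ancilla state that have the type opposite to $\mu$ (stabilizer generators of $\mathcal Q$ and stabilizing logical operators), as binary vectors, and let $\mathcal{SC}_\mu=\langle S_\mu\rangle$. The complete syndrome of an error $e\in\mathbb Z_2^n$ of type $\mu$ is $(h\cdot e)_{h\in\mathcal{SC}_\mu}$. Errors of type $\mu$ that differ by a stabilizer of the state are identified, and the weight $\mathrm{wt}(e)$ is the least Hamming weight in the class of $e$. **Sparsity.** Choose for each complete syndrome an error of least weight that has this syndrome. Let $\mathbb S_\cap$ (respectively $\mathbb S_\emptyset$) be the set of pairs of distinct complete syndromes whose errors have intersecting (respectively disjoint) supports.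 $\mathcal Q$ is $\epsilon$-sparse (for $\mu$) if $|\mathbb S_\cap|/|\mathbb S_\emptyset|<\epsilon$ for some such choice. **One round of distillation.** Let $\mathcal C_{c_\mu}$ be a classical binary code with parity-check matrix $\mathsf H_{c}=[\mathsf I_r|\mathsf A]$, with a decoder that corrects all patterns of at most $t_{c_\mu}$ errors. Take $r$ check blocks and $m$ output blocks. They are prepared by noisy procedures with independent failures. Each procedure has finitely many noisy gates and possible bit flips, whose failures determine the error on the block or its rejection, and a procedure without failures accepts an error-free block. For each entry $\mathsf A_{ij}=1$, in any order, a transversal CNOT is applied between output block $j$ and check block $i$. The output block is the control if $\mu=X$ and the target if $\mu=Z$. The qubits of the check blocks are then measured in the $Z$ basis if $\mu=X$, and in the $X$ basis if $\mu=Z$. All failures are independent: each CNOT is followed with probability $p$ by one of the 15 nontrivial two-qubit Pauli operators, chosen uniformly, and each measurement outcome is flipped with probability $p$. For each $h\in\mathcal{SC}_\mu$, the parities $h\cdot\nu^{(i)}$ of the outcomes $\nu^{(1)},\dots,\nu^{(r)}$ are decoded classically, which gives an estimated syndrome bit $\widetilde{\mathsf{sc}}_{j,h}$ for each block $j$. The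 estimated complete syndrome set of output block $j$ is *valid* if $\widetilde{\mathsf{sc}}_{j,h}=\sum_{l}\widetilde{\mathsf{sc}}_{j,g_l}$ for every product $h$ of generators $g_l\in S_\mu$. The block is then corrected by some error of type $\mu$ that has the estimated syndrome bits on $S_\mu$. Ideal postselection keeps exactly the blocks with a valid set; "accepted" below means that the set of block $j$ is valid and that no input block was rejected by its preparation. **Qualified.** A residual error $e$ of type $\mu$ on output block $j$ is *uncorrelated* if its probability, conditioned on acceptance of $j$, is $O(p^s)$ as $p\to0$ for some $s\ge \mathrm{wt}(e)$ if $\mathrm{wt}(e)\le t$, and for some $s\ge t$ if $\mathrm{wt}(e)>t$. Otherwise it is *correlated*. The block is *qualified* if its residual error is not correlated. **Theorem.** There is a universal constant $C>0$ with the following property. If, in the setting above, $\mathcal Q$ is $\epsilon$-sparse and $t_{c_\mu}\ge t-1$, then for every output block $j$ and every $0<p<1$, conditioned on acceptance of $j$ (that is, on a valid estimated complete syndrome set), the block $j$ is qualified with probability at least $1-C\epsilon$. -/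

import Mathlib

open Filter Topology Asymptotics

/-- The two types of Pauli errors. -/
inductive PauliType
  | X
  | Z

/-- The type that anticommutes with the given one. -/
def PauliType.dual : PauliType → PauliType
  | .X => .Z
  | .Z => .X

/-- Binary vectors of length `n`. -/
abbrev BVec (n : ℕ) : Type := Fin n → ZMod 2

/-- A one-qubit Pauli operator `X^x Z^z` up to phase, written as `(x, z)`. The identity is `0`. -/
abbrev Pauli : Type := ZMod 2 × ZMod 2

/-- The exponent of `X`, or of `Z`, in a one-qubit Pauli operator. -/
def Pauli.part : PauliType → Pauli → ZMod 2
  | .X, P => P.1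
  | .Z, P => P.2

/-- An `n`-qubit Pauli operator up to phase. -/
abbrev PauliString (n : ℕ) : Type := Fin n → Pauli

/-- The binary vector of the `X` part, or of the `Z` part, of a Pauli operator. -/
def PauliString.part {n : ℕ} (μ : PauliType) (E : PauliString n) : BVec n :=
  fun q => Pauli.part μ (E q)

/-! ### CSS codes and their ancilla states -/

/-- An `[[n, k]]` CSS code: full-rank parity-check matrices `HX`, `HZ` of the two classical codes
`C_X`, `C_Z` with `C_X^⊥ ⊆ C_Z`, and logical operators `X̄_i` (rows of `LX`) and `Z̄_i`
(rows of `LZ`) that commute with the stabilizers and satisfy the Pauli relations. -/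
structure CSSCode (n rX rZ k : ℕ) where
  HX : Matrix (Fin rX) (Fin n) (ZMod 2)
  HZ : Matrix (Fin rZ) (Fin n) (ZMod 2)
  LX : Matrix (Fin k) (Fin n) (ZMod 2)
  LZ : Matrix (Fin k) (Fin n) (ZMod 2)
  indepX : LinearIndependent (ZMod 2) (fun i => HX i)
  indepZ : LinearIndependent (ZMod 2) (fun i => HZ i)
  card_eq : rX + rZ + k = n
  orth : HX * HZ.transpose = 0
  logicalX : HZ * LX.transpose = 0
  logicalZ : HX * LZ.transpose = 0
  logical : LX * LZ.transpose = 1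

namespace CSSCode

variable {n rX rZ k : ℕ}

/-- The code corrects every Pauli error on at most `t` qubits: two such errors with the same
error syndrome differ by an element of the stabilizer group of the code. -/
def CorrectsErrors (Q : CSSCode n rX rZ k) (t : ℕ) : Prop :=
  ∀ E F : PauliString n, hammingNorm E ≤ t → hammingNorm F ≤ t →
    Q.HZ.mulVec (E.part .X) = Q.HZ.mulVec (F.part .X) →
    Q.HX.mulVec (E.part .Z) = Q.HX.mulVec (F.part .Z) →
    E.part .X - F.part .X ∈ Submodule.span (ZMod 2) (Set.range fun i => Q.HX i) ∧
    E.part .Z - F.part .Z ∈ Submodule.span (ZMod 2) (Set.range fun i => Q.HZ i)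

/-- Generators of type `X` or `Z` of the stabilizer group of the ancilla state in which the `i`th
logical qubit is stabilized by `Z̄_i` (that is, it is `|0⟩`) if `a i = Z`, and by `X̄_i`
(that is, it is `|+⟩`) if `a i = X`. -/
def gens (Q : CSSCode n rX rZ k) (a : Fin k → PauliType) : PauliType → Set (BVec n)
  | .X => (Set.range fun i => Q.HX i) ∪ {v | ∃ i, a i = .X ∧ v = Q.LX i}
  | .Z => (Set.range fun i => Q.HZ i) ∪ {v | ∃ i, a i = .Z ∧ v = Q.LZ i}

/-- The stabilizers that are elements of the given type, as binary vectors. -/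
def stab (Q : CSSCode n rX rZ k) (a : Fin k → PauliType) (ν : PauliType) :
    Submodule (ZMod 2) (BVec n) :=
  Submodule.span (ZMod 2) (Q.gens a ν)

/-- The generators whose eigenvalues are estimated in the round that removes errors of type `μ`;
they are of the dual type. -/
def checkGens (Q : CSSCode n rX rZ k) (a : Fin k → PauliType) (μ : PauliType) : Set (BVec n) :=
  Q.gens a μ.dual

/-- The group generated by `checkGens`. -/
def checkGroup (Q : CSSCode n rX rZ k) (a : Fin k → PauliType) (μ : PauliType) :
    Submodule (ZMod 2) (BVec n) :=
  Submodule.span (ZMod 2) (Q.checkGens a μ)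

/-- Two errors of type `μ` have the same effect on the ancilla state. -/
def SameError (Q : CSSCode n rX rZ k) (a : Fin k → PauliType) (μ : PauliType)
    (e f : BVec n) : Prop :=
  e - f ∈ Q.stab a μ

/-- The weight of an error of type `μ` on the ancilla state: the least weight of an error with
the same effect. -/
noncomputable def errorWeight (Q : CSSCode n rX rZ k) (a : Fin k → PauliType) (μ : PauliType)
    (e : BVec n) : ℕ :=
  sInf {w | ∃ f, Q.SameError a μ e f ∧ w = hammingNorm f}

/-- The complete syndrome of an error of type `μ`: one bit for each element of the group. -/
def completeSyndrome (Q : CSSCode n rX rZ k) (a : Fin k → PauliType) (μ : PauliType)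
    (e : BVec n) : Q.checkGroup a μ → ZMod 2 :=
  fun h => h.1 ⬝ᵥ e

/-- `ρ` assigns to each complete syndrome an error of least weight with that syndrome. -/
def IsMinErrorMap (Q : CSSCode n rX rZ k) (a : Fin k → PauliType) (μ : PauliType)
    (ρ : (Q.checkGroup a μ → ZMod 2) → BVec n) : Prop :=
  ∀ e : BVec n,
    Q.completeSyndrome a μ (ρ (Q.completeSyndrome a μ e)) = Q.completeSyndrome a μ e ∧
    hammingNorm (ρ (Q.completeSyndrome a μ e)) ≤ hammingNorm e

/-- Pairs of distinct complete syndromes whose errors have intersecting supports. -/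
def meetingPairs (Q : CSSCode n rX rZ k) (a : Fin k → PauliType) (μ : PauliType)
    (ρ : (Q.checkGroup a μ → ZMod 2) → BVec n) :
    Set ((Q.checkGroup a μ → ZMod 2) × (Q.checkGroup a μ → ZMod 2)) :=
  {s | s.1 ∈ Set.range (Q.completeSyndrome a μ) ∧ s.2 ∈ Set.range (Q.completeSyndrome a μ) ∧
    s.1 ≠ s.2 ∧ ∃ q, ρ s.1 q ≠ 0 ∧ ρ s.2 q ≠ 0}

/-- Pairs of distinct complete syndromes whose errors have disjoint supports. -/
def disjointPairs (Q : CSSCode n rX rZ k) (a : Fin k → PauliType) (μ : PauliType)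
    (ρ : (Q.checkGroup a μ → ZMod 2) → BVec n) :
    Set ((Q.checkGroup a μ → ZMod 2) × (Q.checkGroup a μ → ZMod 2)) :=
  {s | s.1 ∈ Set.range (Q.completeSyndrome a μ) ∧ s.2 ∈ Set.range (Q.completeSyndrome a μ) ∧
    s.1 ≠ s.2 ∧ ¬ ∃ q, ρ s.1 q ≠ 0 ∧ ρ s.2 q ≠ 0}

/-- The code is `ε`-sparse with respect to the complete syndromes for errors of type `μ`. -/
def IsSparse (Q : CSSCode n rX rZ k) (a : Fin k → PauliType) (μ : PauliType) (ε : ℝ) : Prop :=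
  ∃ ρ, Q.IsMinErrorMap a μ ρ ∧
    ((Q.meetingPairs a μ ρ).ncard : ℝ) / ((Q.disjointPairs a μ ρ).ncard : ℝ) < ε

end CSSCode

/-! ### Failures -/

/-- Probability of a CNOT failure: with probability `p` the gate is followed by one of the `15`
nontrivial two-qubit Pauli operators, all equally likely; `0` is the absence of a failure. -/
noncomputable def gateWeight (p : ℝ) (g : Pauli × Pauli) : ℝ :=
  if g = 0 then 1 - p else p / 15

/-- Probability of a classical bit flip: the value `1` is a flip, which occurs with
probability `p`. -/
noncomputable def flipWeight (p : ℝ) (b : ZMod 2) : ℝ :=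
  if b = 0 then 1 - p else p

/-- A noisy procedure that prepares one ancilla block, for example an encoding circuit, or an
encoding followed by an earlier round with postselection. It has finitely many noisy gates and
finitely many locations where a bit can flip. The failures determine the Pauli error on the block
(`some E`), or that the block is rejected (`none`). Without failures the block is accepted and free
of errors. -/
structure NoisyPreparation (n : ℕ) where
  gates : ℕ
  flips : ℕ
  outcome : (Fin gates → Pauli × Pauli) → (Fin flips → ZMod 2) → Option (PauliString n)
  outcome_zero : outcome 0 0 = some 0

/-- The blocks of a round: `r` check blocks, followed by `m` output blocks. -/
abbrev Block (r m : ℕ) : Type := Fin r ⊕ Fin m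

/-- The parity-check matrix `[I | A]`. -/
def systematic {r m : ℕ} (A : Matrix (Fin r) (Fin m) (ZMod 2)) :
    Matrix (Fin r) (Block r m) (ZMod 2) :=
  Matrix.fromCols 1 A

/-! ### One round of distillation -/

/-- A round of distillation that removes errors of type `μ`, based on the classical code with
parity-check matrix `[I | A]`.
* `schedule` lists the transversal CNOTs in the order of their execution, one for every entry `1`
  of `A`.
* `decode` is the decoder of the classical code: from the syndrome of a column of the syndrome
  array it estimates that column.
* `prep b` prepares the input block `b`.
* `recover` is the quantum decoder: it returns an error with the given generalized syndrome. -/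
structure DistillationRound {n rX rZ k : ℕ} (Q : CSSCode n rX rZ k) (a : Fin k → PauliType)
    (μ : PauliType) (r m : ℕ) where
  A : Matrix (Fin r) (Fin m) (ZMod 2)
  schedule : List (Fin r × Fin m)
  schedule_nodup : schedule.Nodup
  mem_schedule : ∀ i j, (i, j) ∈ schedule ↔ A i j = 1
  decode : (Fin r → ZMod 2) → (Block r m → ZMod 2)
  prep : Block r m → NoisyPreparation n
  recover : (Q.checkGens a μ → ZMod 2) → BVec n
  recover_spec : ∀ (s : Q.checkGens a μ → ZMod 2) (h : Q.checkGens a μ), h.1 ⬝ᵥ recover s = s h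

/-- The Pauli errors on all qubits of all blocks. -/
abbrev Frame (r m n : ℕ) : Type := Block r m → PauliString n

/-- A perfect transversal CNOT from block `c` to block `d`: `X` errors are copied from control to
target and `Z` errors from target to control. -/
def cnotFrame {r m n : ℕ} (c d : Block r m) (F : Frame r m n) : Frame r m n :=
  fun b q =>
    if b = c then ((F c q).1, (F c q).2 + (F d q).2)
    else if b = d then ((F d q).1 + (F c q).1, (F d q).2)
    else F b q

/-- Failures after a transversal CNOT from block `c` to block `d`: on the `q`th pair of qubits the
two-qubit Pauli operator `g q` acts, its first factor on the control. -/
def failFrame {r m n : ℕ} (c d : Block r m) (g : Fin n → Pauli × Pauli) (F : Frame r m n) :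
    Frame r m n :=
  fun b q =>
    if b = c then F c q + (g q).1
    else if b = d then F d q + (g q).2
    else F b q

/-- Control and target of the transversal CNOT between check block `i` and output block `j`.
To remove `X` errors the output block is the control and the check block is measured in the
`Z` basis; to remove `Z` errors the roles and the bases are exchanged. -/
def cnotEnds {r m : ℕ} : PauliType → Fin r × Fin m → Block r m × Block r m
  | .X, (i, j) => (Sum.inr j, Sum.inl i)
  | .Z, (i, j) => (Sum.inl i, Sum.inr j)

namespace DistillationRound

variable {n rX rZ k r m : ℕ} {Q : CSSCode n rX rZ k} {a : Fin k → PauliType} {μ : PauliType}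

/-- The decoder of the classical code corrects all patterns of at most `tc` errors. -/
def CorrectsErrors (R : DistillationRound Q a μ r m) (tc : ℕ) : Prop :=
  ∀ v : Block r m → ZMod 2, hammingNorm v ≤ tc → R.decode ((systematic R.A).mulVec v) = v

/-- All failures of the round: those in the preparation of each input block, those of every CNOT
of the distillation circuit, and those of every measurement of a qubit of a check block. -/
abbrev Failures (R : DistillationRound Q a μ r m) : Type :=
  ((b : Block r m) → (Fin (R.prep b).gates → Pauli × Pauli) × (Fin (R.prep b).flips → ZMod 2)) ×
  (Fin R.schedule.length → Fin n → Pauli × Pauli) ×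
  (Fin r → Fin n → ZMod 2)

/-- The probability of a failure pattern; all failures are independent. -/
noncomputable def weight (R : DistillationRound Q a μ r m) (p : ℝ) (ω : R.Failures) : ℝ :=
  (∏ b, ((∏ g, gateWeight p ((ω.1 b).1 g)) * ∏ f, flipWeight p ((ω.1 b).2 f))) *
  (∏ l, ∏ q, gateWeight p (ω.2.1 l q)) *
  (∏ i, ∏ q, flipWeight p (ω.2.2 i q))

open Classical in
/-- The probability of an event at failure rate `p`. -/
noncomputable def prob (R : DistillationRound Q a μ r m) (p : ℝ) (S : Set R.Failures) : ℝ :=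
  ∑ ω, if ω ∈ S then R.weight p ω else 0

/-- The conditional probability of the event `S` given the event `T`. -/
noncomputable def condProb (R : DistillationRound Q a μ r m) (p : ℝ) (S T : Set R.Failures) : ℝ :=
  R.prob p (S ∩ T) / R.prob p T

/-- The outcome of the preparation of an input block. -/
def inputOutcome (R : DistillationRound Q a μ r m) (ω : R.Failures) (b : Block r m) :
    Option (PauliString n) :=
  (R.prep b).outcome (ω.1 b).1 (ω.1 b).2

/-- The errors on the input blocks (relevant only if no input block was rejected). -/
def inputFrame (R : DistillationRound Q a μ r m) (ω : R.Failures) : Frame r m n :=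
  fun b => (R.inputOutcome ω b).getD 0

/-- The errors on all blocks after the noisy CNOTs of the distillation circuit. -/
def finalFrame (R : DistillationRound Q a μ r m) (ω : R.Failures) : Frame r m n :=
  (List.finRange R.schedule.length).foldl
    (fun F l =>
      let e := cnotEnds μ (R.schedule.get l)
      failFrame e.1 e.2 (ω.2.1 l) (cnotFrame e.1 e.2 F))
    (R.inputFrame ω)

/-- The outcomes of the bitwise measurement of check block `i`, relative to the outcomes of a
perfect circuit (those are orthogonal to every check, so that they never contribute to a parity
that is used). -/
def measured (R : DistillationRound Q a μ r m) (ω : R.Failures) (i : Fin r) : BVec n :=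
  fun q => Pauli.part μ (R.finalFrame ω (Sum.inl i) q) + ω.2.2 i q

/-- The estimated syndrome bit of the stabilizer `h` on output block `j`. -/
def estimate (R : DistillationRound Q a μ r m) (ω : R.Failures) (j : Fin m) (h : BVec n) : ZMod 2 :=
  R.decode (fun i => h ⬝ᵥ R.measured ω i) (Sum.inr j)

/-- The estimated complete syndrome set of output block `j` is valid: the bit of every product of
generators is the sum of the bits of these generators. -/
def IsValid (R : DistillationRound Q a μ r m) (ω : R.Failures) (j : Fin m) : Prop :=
  ∀ T : Finset (BVec n), (T : Set (BVec n)) ⊆ Q.checkGens a μ →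
    R.estimate ω j (∑ g ∈ T, g) = ∑ g ∈ T, R.estimate ω j g

/-- The event that the input blocks were all accepted by their preparation, and that output block
`j` has a valid estimated complete syndrome set and thus passes ideal postselection. -/
def accepted (R : DistillationRound Q a μ r m) (j : Fin m) : Set R.Failures :=
  {ω | (∀ b, R.inputOutcome ω b ≠ none) ∧ R.IsValid ω j}

/-- The error of type `μ` left on output block `j` after the correction that is based on the
estimated syndrome bits of the generators. -/
def residual (R : DistillationRound Q a μ r m) (ω : R.Failures) (j : Fin m) : BVec n :=
  PauliString.part μ (R.finalFrame ω (Sum.inr j)) + R.recover (fun h => R.estimate ω j h.1)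

/-- The error `e` is uncorrelated on the accepted output block `j`, for a code that corrects `t`
errors: as the failure rate `p` tends to `0`, its probability is `O(p ^ s)` for some `s` that is at
least the weight of `e` if this weight is at most `t`, and at least `t` otherwise. -/
def IsUncorrelated (R : DistillationRound Q a μ r m) (t : ℕ) (j : Fin m) (e : BVec n) : Prop :=
  ∃ s : ℕ, (Q.errorWeight a μ e ≤ t → Q.errorWeight a μ e ≤ s) ∧
    (t < Q.errorWeight a μ e → t ≤ s) ∧
    (fun p : ℝ => R.condProb p {ω | Q.SameError a μ (R.residual ω j) e} (R.accepted j))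
      =O[𝓝[>] 0] (fun p : ℝ => p ^ s)

/-- The event that output block `j` carries no correlated error. -/
def qualified (R : DistillationRound Q a μ r m) (t : ℕ) (j : Fin m) : Set R.Failures :=
  {ω | R.IsUncorrelated t j (R.residual ω j)}

end DistillationRound

/-! The proof shows more than is claimed: on an accepted block *no* residual error is correlated, so
that an accepted block is qualified with probability one, and `C = 1` works because sparsity forces
`0 < ε`.

Fix an accepted failure pattern with `s < t` failures, so that `s ≤ tc`, and consider the elements
`h` of the group of checks that vanish on every qubit at which a CNOT or a measurement failed. For
such an `h` the round acts as if its CNOTs and measurements were perfect, because errors of type `μ`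
spread only qubitwise, from output blocks to check blocks. The parities of `h` therefore are the
classical syndrome of the column of the values of `h` on the input errors, and that column has
weight at most the number of failures in preparations, hence at most `tc`: the estimate is correct
(`estimate_eq_of_vanishes`). Validity says that the estimate is linear on the group of checks, so it
agrees with the pairing with the correction, and the residual error is orthogonal to every such `h`
(`dotProduct_residual_eq_zero`). By duality for functionals, and because the stabilizers of type `μ`
are the orthogonal complement of the checks (`mem_stab_of_orthogonal`, a dimension count), the
residual error is equivalent to one that is supported on the failed qubits. Its weight is
thus at most `s` (`errorWeight_le_failureCount`).

Hence an error `e` arises on an accepted block only from at least `min (wt e) t` failures. A pattern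
of `s` failures has probability at most `p ^ s`, and the probability of acceptance tends to `1` as
`p → 0`, which gives the required bound on the conditional probability of `e`. -/

/-! ### Binary linear algebra -/

/-- If the row spaces of two matrices with independent rows are orthogonal and have complementary
dimensions, then each of them is the whole orthogonal complement of the other. -/
theorem mem_span_rows_of_mulVec_eq_zero {K ι κ : Type*} [Field K] [Fintype ι] [Fintype κ] {n : ℕ}
    (G : Matrix ι (Fin n) K) (H : Matrix κ (Fin n) K)
    (hG : LinearIndependent K G.row) (hH : LinearIndependent K H.row)
    (orth : H * G.transpose = 0) (hcard : Fintype.card ι + Fintype.card κ = n)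
    {e : Fin n → K} (he : H.mulVec e = 0) : e ∈ Submodule.span K (Set.range G.row) := by
  have hle : Submodule.span K (Set.range G.row) ≤ LinearMap.ker H.mulVecLin := by
    rw [Submodule.span_le]
    rintro _ ⟨i, rfl⟩
    ext c
    exact congrFun (congrFun orth c) i
  have hrank : H.rank = Fintype.card κ := hH.rank_matrix
  have hnull := LinearMap.finrank_range_add_finrank_ker H.mulVecLin
  rw [Module.finrank_fin_fun] at hnull
  have hspan := finrank_span_eq_card hG
  have heq := Submodule.eq_of_le_of_finrank_eq hle (by
    unfold Matrix.rank at hrank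
    omega)
  rw [heq]
  exact he

theorem linearIndependent_fromRows {K ι κ ν : Type*} [Field K] [Fintype ι] [Fintype κ]
    [DecidableEq κ] [Fintype ν] {H : Matrix ι ν K} {L D : Matrix κ ν K}
    (hH : LinearIndependent K H.row) (hHD : H * D.transpose = 0) (hLD : L * D.transpose = 1) :
    LinearIndependent K (Matrix.fromRows H L).row := by
  rw [← Matrix.vecMul_injective_iff] at hH ⊢
  have key : ∀ v, Matrix.vecMul v (Matrix.fromRows H L) = 0 → v = 0 := by
    intro v hv
    rw [Matrix.vecMul_fromRows] at hv
    -- pairing with the rows of `D` isolates the coefficients of the rows of `L`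
    have hr : v ∘ Sum.inr = 0 := by
      have := congrArg (fun w => Matrix.vecMul w D.transpose) hv
      simpa [Matrix.add_vecMul, Matrix.vecMul_vecMul, hHD, hLD] using this
    have hl : v ∘ Sum.inl = 0 := by
      apply hH
      simpa [hr] using hv
    funext b
    rcases b with b | b
    · exact congrFun hl b
    · exact congrFun hr b
  intro v w hvw
  rw [← sub_eq_zero]
  apply key
  simpa [Matrix.sub_vecMul, sub_eq_zero] using hvw

/-- Over the field with two elements, the elements of a span are the sums of finite subsets. -/
theorem exists_sum_of_mem_span_zmod_two {M : Type*} [AddCommGroup M] [Module (ZMod 2) M]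
    {S : Set M} {h : M} (hh : h ∈ Submodule.span (ZMod 2) S) :
    ∃ T : Finset M, (T : Set M) ⊆ S ∧ ∑ g ∈ T, g = h := by
  obtain ⟨c, hc, rfl⟩ := Submodule.mem_span_set.1 hh
  refine ⟨c.support, hc, ?_⟩
  refine Finset.sum_congr rfl fun g hg => ?_
  have h1 : ∀ x : ZMod 2, x ≠ 0 → x = 1 := by decide
  show g = c g • g
  rw [h1 _ (Finsupp.mem_support_iff.1 hg), one_smul]

/-- A vector that is orthogonal to all elements of `V` that vanish on `D` can be changed by a vector
supported on `D` into one that is orthogonal to `V`. -/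
theorem exists_supported_of_orthogonal {K : Type*} [Field K] [DecidableEq K] {n : ℕ}
    (V : Submodule K (Fin n → K)) (D : Finset (Fin n)) (e : Fin n → K)
    (he : ∀ h ∈ V, (∀ q ∈ D, h q = 0) → h ⬝ᵥ e = 0) :
    ∃ f : Fin n → K, hammingNorm f ≤ D.card ∧ ∀ h ∈ V, h ⬝ᵥ (e - f) = 0 := by
  classical
  let L : D → Module.Dual K V := fun q => (LinearMap.proj q.1).comp V.subtype
  let φ : Module.Dual K V :=
    { toFun := fun h => h.1 ⬝ᵥ e
      map_add' := fun x y => by simp [add_dotProduct]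
      map_smul' := fun c x => by simp [smul_dotProduct] }
  have hφ : φ ∈ Submodule.span K (Set.range L) := by
    apply mem_span_of_iInf_ker_le_ker
    intro h hh
    simp only [Submodule.mem_iInf, LinearMap.mem_ker] at hh
    exact he h.1 h.2 fun q hq => hh ⟨q, hq⟩
  obtain ⟨c, hc⟩ := (Submodule.mem_span_range_iff_exists_fun K).1 hφ
  refine ⟨fun q => if hq : q ∈ D then c ⟨q, hq⟩ else 0, ?_, fun h hh => ?_⟩
  · refine Finset.card_le_card fun q hq => ?_
    by_contra hD
    simp [hD] at hq
  · rw [dotProduct_sub, sub_eq_zero]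
    have h1 : h ⬝ᵥ e = ∑ q : D, c q * h q.1 := by
      have := LinearMap.congr_fun hc ⟨h, hh⟩
      simpa [L, φ] using this.symm
    rw [h1, dotProduct, ← Finset.sum_subset (Finset.subset_univ D), ← Finset.sum_attach D]
    · refine Finset.sum_congr rfl fun q _ => ?_
      simp [mul_comm]
    · intro q _ hq
      simp [hq]

/-! ### Stabilizers and checks -/

namespace CSSCode

variable {n rX rZ k : ℕ} (Q : CSSCode n rX rZ k) (a : Fin k → PauliType)

theorem range_row_fromRows {ι : Type*} (H : Matrix ι (Fin n) (ZMod 2))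
    (L : Matrix (Fin k) (Fin n) (ZMod 2)) (ν : PauliType) :
    Set.range (Matrix.fromRows H (L.submatrix (fun i : {i // a i = ν} => i.1) id)).row =
      (Set.range fun i => H i) ∪ {v | ∃ i, a i = ν ∧ v = L i} := by
  ext v
  constructor
  · rintro ⟨i | i, rfl⟩
    · exact Or.inl ⟨i, rfl⟩
    · exact Or.inr ⟨i.1, i.2, rfl⟩
  · rintro (⟨i, rfl⟩ | ⟨i, hi, rfl⟩)
    · exact ⟨Sum.inl i, rfl⟩
    · exact ⟨Sum.inr ⟨i, hi⟩, rfl⟩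

/-- The stabilizers of type `μ` are the orthogonal complement of the checks, since the two groups
are orthogonal and together have `n` independent generators. -/
theorem mem_stab_of_orthogonal (μ : PauliType) {e : BVec n}
    (he : ∀ h ∈ Q.checkGroup a μ, h ⬝ᵥ e = 0) : e ∈ Q.stab a μ := by
  classical
  let GX := Matrix.fromRows Q.HX (Q.LX.submatrix (fun i : {i // a i = .X} => i.1) id)
  let GZ := Matrix.fromRows Q.HZ (Q.LZ.submatrix (fun i : {i // a i = .Z} => i.1) id)
  have hX : Set.range GX.row = Q.gens a .X := range_row_fromRows a Q.HX Q.LX .X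
  have hZ : Set.range GZ.row = Q.gens a .Z := range_row_fromRows a Q.HZ Q.LZ .Z
  have logical' : Q.LZ * Q.LX.transpose = 1 := by
    simpa using congrArg Matrix.transpose Q.logical
  have iX : LinearIndependent (ZMod 2) GX.row := by
    refine linearIndependent_fromRows
      (D := Q.LZ.submatrix (fun i : {i // a i = .X} => i.1) id) Q.indepX ?_ ?_
    · ext i j
      exact congrFun (congrFun Q.logicalZ i) j.1
    · ext i j
      refine (congrFun (congrFun Q.logical i.1) j.1).trans ?_
      simp [Matrix.one_apply, Subtype.ext_iff]
  have iZ : LinearIndependent (ZMod 2) GZ.row := by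
    refine linearIndependent_fromRows
      (D := Q.LX.submatrix (fun i : {i // a i = .Z} => i.1) id) Q.indepZ ?_ ?_
    · ext i j
      exact congrFun (congrFun Q.logicalX i) j.1
    · ext i j
      refine (congrFun (congrFun logical' i.1) j.1).trans ?_
      simp [Matrix.one_apply, Subtype.ext_iff]
  have orthXZ : GX * GZ.transpose = 0 := by
    ext i j
    rcases i with i | i <;> rcases j with j | j
    · exact congrFun (congrFun Q.orth i) j
    · exact congrFun (congrFun Q.logicalZ i) j.1
    · exact (dotProduct_comm _ _).trans (congrFun (congrFun Q.logicalX j) i.1)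
    · refine (congrFun (congrFun Q.logical i.1) j.1).trans (Matrix.one_apply_ne fun hij => ?_)
      have h1 := i.2
      rw [hij, j.2] at h1
      cases h1
  have orthZX : GZ * GX.transpose = 0 := by
    simpa using congrArg Matrix.transpose orthXZ
  have hcard : Fintype.card {i // a i = .X} + Fintype.card {i // a i = .Z} = k := by
    have h1 := Fintype.card_subtype_compl (fun i => a i = .X)
    have h2 : Fintype.card {i // ¬ a i = .X} = Fintype.card {i // a i = .Z} := by
      refine Fintype.card_congr (Equiv.subtypeEquivRight fun i => ?_)
      cases a i <;> simp
    have h3 := Fintype.card_subtype_le (fun i => a i = .X)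
    rw [Fintype.card_fin] at h1 h3
    omega
  have hn := Q.card_eq
  cases μ with
  | X =>
    rw [stab, ← hX]
    refine mem_span_rows_of_mulVec_eq_zero GX GZ iX iZ orthZX ?_ ?_
    · simp only [Fintype.card_sum, Fintype.card_fin]
      omega
    · funext c
      refine he _ (Submodule.subset_span ?_)
      change _ ∈ Q.gens a .Z
      rw [← hZ]
      exact ⟨c, rfl⟩
  | Z =>
    rw [stab, ← hZ]
    refine mem_span_rows_of_mulVec_eq_zero GZ GX iZ iX orthXZ ?_ ?_
    · simp only [Fintype.card_sum, Fintype.card_fin]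
      omega
    · funext c
      refine he _ (Submodule.subset_span ?_)
      change _ ∈ Q.gens a .X
      rw [← hX]
      exact ⟨c, rfl⟩

end CSSCode

/-! ### Propagation of errors through a round -/

/-- The value of the check `h` on the type-`μ` part of the errors of each block. -/
def frameSyndrome {r m n : ℕ} (μ : PauliType) (h : BVec n) (F : Frame r m n) (b : Block r m) :
    ZMod 2 :=
  h ⬝ᵥ PauliString.part μ (F b)

theorem frameSyndrome_failFrame {r m n : ℕ} (μ : PauliType) (h : BVec n) (c d : Block r m)
    (g : Fin n → Pauli × Pauli) (F : Frame r m n) (hg : ∀ q, g q ≠ 0 → h q = 0) :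
    frameSyndrome μ h (failFrame c d g F) = frameSyndrome μ h F := by
  funext b
  unfold frameSyndrome dotProduct
  refine Finset.sum_congr rfl fun q _ => ?_
  by_cases h0 : g q = 0
  · cases μ <;> simp only [PauliString.part, Pauli.part, failFrame, h0] <;> split_ifs <;>
      simp_all
  · simp [hg q h0]

theorem frameSyndrome_cnotFrame {r m n : ℕ} (μ : PauliType) (h : BVec n) (x : Fin r × Fin m)
    (F : Frame r m n) (b : Block r m) :
    frameSyndrome μ h (cnotFrame (cnotEnds μ x).1 (cnotEnds μ x).2 F) b =
      frameSyndrome μ h F b +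
        if b = Sum.inl x.1 then frameSyndrome μ h F (Sum.inr x.2) else 0 := by
  obtain ⟨i, j⟩ := x
  have key : ∀ q, Pauli.part μ (cnotFrame (cnotEnds μ (i, j)).1 (cnotEnds μ (i, j)).2 F b q) =
      Pauli.part μ (F b q) + if b = Sum.inl i then Pauli.part μ (F (Sum.inr j) q) else 0 := by
    intro q
    cases μ
    · by_cases h1 : b = Sum.inr j
      · subst h1; simp [cnotFrame, cnotEnds, Pauli.part]
      · by_cases h2 : b = Sum.inl i
        · subst h2; simp [cnotFrame, cnotEnds, Pauli.part]
        · simp [cnotFrame, cnotEnds, Pauli.part, h1, h2]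
    · by_cases h1 : b = Sum.inr j
      · subst h1; simp [cnotFrame, cnotEnds, Pauli.part]
      · by_cases h2 : b = Sum.inl i
        · subst h2; simp [cnotFrame, cnotEnds, Pauli.part]
        · simp [cnotFrame, cnotEnds, Pauli.part, h1, h2]
  simp only [frameSyndrome, dotProduct, PauliString.part, key]
  split_ifs <;> simp [mul_add, Finset.sum_add_distrib]

namespace DistillationRound

variable {n rX rZ k r m : ℕ} {Q : CSSCode n rX rZ k} {a : Fin k → PauliType} {μ : PauliType}
variable (R : DistillationRound Q a μ r m)

/-- `h` vanishes on all qubits at which a CNOT of the round or a measurement failed. -/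
def Vanishes (ω : R.Failures) (h : BVec n) : Prop :=
  ∀ q, ((∃ l, ω.2.1 l q ≠ 0) ∨ ∃ i, ω.2.2 i q ≠ 0) → h q = 0

variable {R} in
/-- Failed CNOTs are invisible to a vanishing check, and output blocks never receive errors of type
`μ`, so every CNOT adds the initial value of its output block to its check block. -/
theorem frameSyndrome_foldl {ω : R.Failures} {h : BVec n} (hh : R.Vanishes ω h)
    (l : List (Fin R.schedule.length)) (F : Frame r m n) (b : Block r m) :
    frameSyndrome μ h (l.foldl (fun F l =>
      let e := cnotEnds μ (R.schedule.get l)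
      failFrame e.1 e.2 (ω.2.1 l) (cnotFrame e.1 e.2 F)) F) b =
      frameSyndrome μ h F b + (l.map fun x => if b = Sum.inl (R.schedule.get x).1 then
        frameSyndrome μ h F (Sum.inr (R.schedule.get x).2) else 0).sum := by
  induction l generalizing F with
  | nil => simp
  | cons x l ih =>
    have step : ∀ b, frameSyndrome μ h (failFrame (cnotEnds μ (R.schedule.get x)).1
        (cnotEnds μ (R.schedule.get x)).2 (ω.2.1 x)
        (cnotFrame (cnotEnds μ (R.schedule.get x)).1 (cnotEnds μ (R.schedule.get x)).2 F)) b =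
        frameSyndrome μ h F b + if b = Sum.inl (R.schedule.get x).1 then
          frameSyndrome μ h F (Sum.inr (R.schedule.get x).2) else 0 := by
      intro b
      rw [frameSyndrome_failFrame _ _ _ _ _ _ fun q hq => hh q (Or.inl ⟨x, hq⟩)]
      exact frameSyndrome_cnotFrame μ h _ F b
    simp only [List.foldl_cons, List.map_cons, List.sum_cons]
    rw [ih]
    simp only [step]
    simp [add_assoc]

variable {R} in
theorem frameSyndrome_finalFrame_inr {ω : R.Failures} {h : BVec n} (hh : R.Vanishes ω h)
    (j : Fin m) : frameSyndrome μ h (R.finalFrame ω) (Sum.inr j) =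
      frameSyndrome μ h (R.inputFrame ω) (Sum.inr j) := by
  rw [finalFrame, frameSyndrome_foldl hh]
  simp

variable {R} in
theorem frameSyndrome_finalFrame_inl {ω : R.Failures} {h : BVec n} (hh : R.Vanishes ω h)
    (i : Fin r) : frameSyndrome μ h (R.finalFrame ω) (Sum.inl i) =
      (systematic R.A).mulVec (frameSyndrome μ h (R.inputFrame ω)) i := by
  rw [finalFrame, frameSyndrome_foldl hh]
  set s := frameSyndrome μ h (R.inputFrame ω)
  have h1 : ((List.finRange R.schedule.length).map fun x =>
      if (Sum.inl i : Block r m) = Sum.inl (R.schedule.get x).1 then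
        s (Sum.inr (R.schedule.get x).2) else 0) =
      R.schedule.map fun x => if i = x.1 then s (Sum.inr x.2) else 0 := by
    conv_rhs => rw [← List.map_get_finRange R.schedule]
    rw [List.map_map]
    simp [Function.comp_def]
  have h2 : (R.schedule.map fun x => if i = x.1 then s (Sum.inr x.2) else 0).sum =
      ∑ j, R.A i j * s (Sum.inr j) := by
    have hA : ∀ x : ZMod 2, x ≠ 1 → x = 0 := by decide
    rw [← List.sum_toFinset _ R.schedule_nodup, ← Finset.univ_inter R.schedule.toFinset,
      ← Finset.sum_ite_mem, Fintype.sum_prod_type, Finset.sum_eq_single i]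
    · refine Finset.sum_congr rfl fun j _ => ?_
      by_cases hij : R.A i j = 1
      · simp [R.mem_schedule, hij]
      · simp [R.mem_schedule, hA _ hij]
    · intro i' _ hi'
      simp [Ne.symm hi']
    · simp
  rw [h1, h2]
  simp [systematic, Matrix.mulVec, dotProduct, Matrix.fromCols, Fintype.sum_sum_type,
    Matrix.one_apply]

/-! ### Counting failures -/

/-- The number of failures in a failure pattern. -/
def failureCount (ω : R.Failures) : ℕ :=
  (∑ b, (hammingNorm (ω.1 b).1 + hammingNorm (ω.1 b).2)) + (∑ l, hammingNorm (ω.2.1 l)) +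
    ∑ i, hammingNorm (ω.2.2 i)

theorem hammingNorm_frameSyndrome_inputFrame_le (ω : R.Failures) (h : BVec n) :
    hammingNorm (frameSyndrome μ h (R.inputFrame ω)) ≤ R.failureCount ω := by
  have h1 : hammingNorm (frameSyndrome μ h (R.inputFrame ω)) ≤
      ∑ b, (hammingNorm (ω.1 b).1 + hammingNorm (ω.1 b).2) := by
    rw [hammingNorm, Finset.card_filter]
    refine Finset.sum_le_sum fun b _ => ?_
    split_ifs with hb
    · by_contra hlt
      apply hb
      have h0 : hammingNorm (ω.1 b).1 = 0 ∧ hammingNorm (ω.1 b).2 = 0 := by omega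
      rw [hammingNorm_eq_zero, hammingNorm_eq_zero] at h0
      have hE : R.inputFrame ω b = 0 := by
        simp [inputFrame, inputOutcome, h0.1, h0.2, (R.prep b).outcome_zero]
      have hp : PauliString.part μ (0 : PauliString n) = 0 := by
        funext q
        cases μ <;> rfl
      rw [frameSyndrome, hE, hp, dotProduct_zero]
    · exact Nat.zero_le _
  unfold failureCount
  omega

/-! ### Residual errors of few failures -/

variable {R} in
/-- On a check that does not meet the failed qubits, the classical code sees only the blocks with a
failed preparation, and there are few enough of them to be corrected. -/
theorem estimate_eq_of_vanishes {tc : ℕ} (hR : R.CorrectsErrors tc) {ω : R.Failures}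
    (hω : R.failureCount ω ≤ tc) {h : BVec n} (hh : R.Vanishes ω h) (j : Fin m) :
    R.estimate ω j h = frameSyndrome μ h (R.inputFrame ω) (Sum.inr j) := by
  have h1 : (fun i => h ⬝ᵥ R.measured ω i) =
      (systematic R.A).mulVec (frameSyndrome μ h (R.inputFrame ω)) := by
    funext i
    rw [← frameSyndrome_finalFrame_inl hh, frameSyndrome]
    refine Finset.sum_congr rfl fun q _ => ?_
    by_cases h0 : ω.2.2 i q = 0
    · simp [measured, PauliString.part, h0]
    · simp [hh q (Or.inr ⟨i, h0⟩)]
  rw [estimate, h1, hR _ ((R.hammingNorm_frameSyndrome_inputFrame_le ω h).trans hω)]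

variable {R} in
/-- Validity propagates the correctness of the correction from the generators to all checks. -/
theorem dotProduct_recover {ω : R.Failures} {j : Fin m} (hv : R.IsValid ω j) {h : BVec n}
    (hh : h ∈ Q.checkGroup a μ) :
    h ⬝ᵥ R.recover (fun g => R.estimate ω j g.1) = R.estimate ω j h := by
  obtain ⟨T, hT, rfl⟩ := exists_sum_of_mem_span_zmod_two hh
  rw [hv T hT, sum_dotProduct]
  exact Finset.sum_congr rfl fun g hg => R.recover_spec _ ⟨g, hT hg⟩

variable {R} in
/-- The correction removes whatever the checks that avoid the failed qubits can see, including
errors from the preparations of arbitrary weight. -/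
theorem dotProduct_residual_eq_zero {tc : ℕ} (hR : R.CorrectsErrors tc) {ω : R.Failures}
    (hω : R.failureCount ω ≤ tc) {j : Fin m} (hv : R.IsValid ω j) {h : BVec n}
    (hmem : h ∈ Q.checkGroup a μ) (hh : R.Vanishes ω h) : h ⬝ᵥ R.residual ω j = 0 := by
  have h1 := frameSyndrome_finalFrame_inr hh j
  rw [frameSyndrome] at h1
  rw [residual, dotProduct_add, dotProduct_recover hv hmem, estimate_eq_of_vanishes hR hω hh, h1]
  exact CharTwo.add_self_eq_zero _

variable {R} in
/-- The residual error of a correctable number of failures is equivalent to one that is supported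
on the qubits with a failed CNOT or measurement; failures in preparations do not contribute. -/
theorem errorWeight_le_failureCount {tc : ℕ} (hR : R.CorrectsErrors tc) {ω : R.Failures}
    (hω : R.failureCount ω ≤ tc) {j : Fin m} (hv : R.IsValid ω j) {e : BVec n}
    (he : Q.SameError a μ (R.residual ω j) e) : Q.errorWeight a μ e ≤ R.failureCount ω := by
  classical
  let D : Finset (Fin n) :=
    (Finset.univ.biUnion fun l => Finset.univ.filter fun q => ω.2.1 l q ≠ 0) ∪
      Finset.univ.biUnion fun i => Finset.univ.filter fun q => ω.2.2 i q ≠ 0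
  have hD : D.card ≤ R.failureCount ω := by
    have h1 : D.card ≤ (∑ l, hammingNorm (ω.2.1 l)) + ∑ i, hammingNorm (ω.2.2 i) :=
      (Finset.card_union_le _ _).trans
        (add_le_add Finset.card_biUnion_le Finset.card_biUnion_le)
    unfold failureCount
    omega
  obtain ⟨f, hf, horth⟩ := exists_supported_of_orthogonal (Q.checkGroup a μ) D (R.residual ω j)
    fun h hmem hh => dotProduct_residual_eq_zero hR hω hv hmem fun q hq => hh q (by
      simpa [D] using hq)
  have hstab := Q.mem_stab_of_orthogonal a μ horth
  have hsame : Q.SameError a μ e f := by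
    have := Submodule.sub_mem _ hstab he
    simpa [CSSCode.SameError] using this
  have hle : Q.errorWeight a μ e ≤ hammingNorm f := Nat.sInf_le ⟨f, hsame, rfl⟩
  exact hle.trans (hf.trans hD)

/-! ### Probabilities -/

theorem prod_gateWeight_le {ι : Type*} [Fintype ι] {p : ℝ} (h0 : 0 ≤ p) (h1 : p ≤ 1)
    (g : ι → Pauli × Pauli) : ∏ x, gateWeight p (g x) ≤ p ^ hammingNorm g := by
  rw [hammingNorm, Finset.card_filter, ← Finset.prod_pow_eq_pow_sum]
  refine Finset.prod_le_prod (fun x _ => ?_) fun x _ => ?_ <;> unfold gateWeight <;>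
    split_ifs <;> simp_all <;> linarith

theorem prod_flipWeight_le {ι : Type*} [Fintype ι] {p : ℝ} (h0 : 0 ≤ p) (h1 : p ≤ 1)
    (g : ι → ZMod 2) : ∏ x, flipWeight p (g x) ≤ p ^ hammingNorm g := by
  rw [hammingNorm, Finset.card_filter, ← Finset.prod_pow_eq_pow_sum]
  refine Finset.prod_le_prod (fun x _ => ?_) fun x _ => ?_ <;> unfold flipWeight <;>
    split_ifs <;> simp_all

theorem gateWeight_nonneg {p : ℝ} (h0 : 0 ≤ p) (h1 : p ≤ 1) (g : Pauli × Pauli) :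
    0 ≤ gateWeight p g := by
  unfold gateWeight
  split_ifs <;> linarith

theorem flipWeight_nonneg {p : ℝ} (h0 : 0 ≤ p) (h1 : p ≤ 1) (b : ZMod 2) :
    0 ≤ flipWeight p b := by
  unfold flipWeight
  split_ifs <;> linarith

theorem weight_nonneg {p : ℝ} (h0 : 0 ≤ p) (h1 : p ≤ 1) (ω : R.Failures) : 0 ≤ R.weight p ω := by
  have hg := gateWeight_nonneg h0 h1
  have hf := flipWeight_nonneg h0 h1
  unfold weight
  refine mul_nonneg (mul_nonneg ?_ ?_) ?_
  · exact Finset.prod_nonneg fun b _ => mul_nonneg (Finset.prod_nonneg fun _ _ => hg _)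
      (Finset.prod_nonneg fun _ _ => hf _)
  · exact Finset.prod_nonneg fun _ _ => Finset.prod_nonneg fun _ _ => hg _
  · exact Finset.prod_nonneg fun _ _ => Finset.prod_nonneg fun _ _ => hf _

theorem weight_le_pow_failureCount {p : ℝ} (h0 : 0 ≤ p) (h1 : p ≤ 1) (ω : R.Failures) :
    R.weight p ω ≤ p ^ R.failureCount ω := by
  have hg := gateWeight_nonneg h0 h1
  have hf := flipWeight_nonneg h0 h1
  unfold weight failureCount
  rw [pow_add, pow_add, ← Finset.prod_pow_eq_pow_sum, ← Finset.prod_pow_eq_pow_sum,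
    ← Finset.prod_pow_eq_pow_sum]
  have hgn : ∀ {ι : Type} [Fintype ι] (g : ι → Pauli × Pauli), 0 ≤ ∏ x, gateWeight p (g x) :=
    fun g => Finset.prod_nonneg fun _ _ => hg _
  have hfn : ∀ {ι : Type} [Fintype ι] (g : ι → ZMod 2), 0 ≤ ∏ x, flipWeight p (g x) :=
    fun g => Finset.prod_nonneg fun _ _ => hf _
  refine mul_le_mul (mul_le_mul ?_ ?_ ?_ ?_) ?_ ?_ ?_
  · refine Finset.prod_le_prod (fun b _ => mul_nonneg (hgn _) (hfn _)) fun b _ => ?_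
    rw [pow_add]
    exact mul_le_mul (prod_gateWeight_le h0 h1 _) (prod_flipWeight_le h0 h1 _) (hfn _)
      (pow_nonneg h0 _)
  · exact Finset.prod_le_prod (fun _ _ => hgn _) fun _ _ => prod_gateWeight_le h0 h1 _
  · exact Finset.prod_nonneg fun _ _ => hgn _
  · exact Finset.prod_nonneg fun _ _ => pow_nonneg h0 _
  · exact Finset.prod_le_prod (fun _ _ => hfn _) fun _ _ => prod_flipWeight_le h0 h1 _
  · exact Finset.prod_nonneg fun _ _ => hfn _
  · exact mul_nonneg (Finset.prod_nonneg fun _ _ => pow_nonneg h0 _)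
      (Finset.prod_nonneg fun _ _ => pow_nonneg h0 _)

theorem weight_zero_pos {p : ℝ} (h1 : p < 1) : 0 < R.weight p 0 := by
  have hp : 0 < 1 - p := by linarith
  unfold weight
  simp [gateWeight, flipWeight]
  positivity

theorem tendsto_weight_zero : Tendsto (fun p => R.weight p 0) (𝓝[>] 0) (𝓝 1) := by
  have hc : Continuous fun p => R.weight p 0 := by
    unfold weight
    simp [gateWeight, flipWeight]
    fun_prop
  have h1 : R.weight 0 0 = 1 := by simp [weight, gateWeight, flipWeight]
  rw [← h1]
  exact hc.continuousAt.tendsto.mono_left nhdsWithin_le_nhds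

theorem prob_nonneg {p : ℝ} (h0 : 0 ≤ p) (h1 : p ≤ 1) (S : Set R.Failures) : 0 ≤ R.prob p S := by
  classical
  refine Finset.sum_nonneg fun ω _ => ?_
  split_ifs
  · exact R.weight_nonneg h0 h1 ω
  · exact le_rfl

variable {R} in
theorem weight_le_prob {p : ℝ} (h0 : 0 ≤ p) (h1 : p ≤ 1) {S : Set R.Failures} {ω : R.Failures}
    (hω : ω ∈ S) : R.weight p ω ≤ R.prob p S := by
  classical
  have h := Finset.single_le_sum (f := fun ω => if ω ∈ S then R.weight p ω else 0)
    (fun ω _ => by split_ifs; exacts [R.weight_nonneg h0 h1 ω, le_rfl]) (Finset.mem_univ ω)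
  simp only [hω, if_true] at h
  unfold prob
  convert h

variable {R} in
theorem prob_le_of_le_failureCount {p : ℝ} (h0 : 0 ≤ p) (h1 : p ≤ 1) {S : Set R.Failures} {s : ℕ}
    (hS : ∀ ω ∈ S, s ≤ R.failureCount ω) :
    R.prob p S ≤ Fintype.card R.Failures * p ^ s := by
  classical
  unfold prob
  refine (Finset.sum_le_card_nsmul _ _ (p ^ s) fun ω _ => ?_).trans_eq (by simp)
  split_ifs with hω
  · exact (R.weight_le_pow_failureCount h0 h1 ω).trans (pow_le_pow_of_le_one h0 h1 (hS ω hω))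
  · exact pow_nonneg h0 s

variable {R} in
theorem zero_mem_accepted {tc : ℕ} (hR : R.CorrectsErrors tc) (j : Fin m) :
    (0 : R.Failures) ∈ R.accepted j := by
  have hcount : R.failureCount 0 ≤ tc := by simp [failureCount]
  have hest : ∀ h : BVec n, R.estimate 0 j h =
      frameSyndrome μ h (R.inputFrame 0) (Sum.inr j) := fun h =>
    estimate_eq_of_vanishes hR hcount (fun q hq => by simp at hq) j
  refine ⟨fun b => ?_, fun T _ => ?_⟩
  · have : R.inputOutcome 0 b = some 0 := (R.prep b).outcome_zero
    simp [this]
  · simp only [hest, frameSyndrome, sum_dotProduct]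

variable {R} in
/-- Every error is uncorrelated. With `t` or more failures the bound `p ^ t` suffices, and with
fewer the hypothesis `t - 1 ≤ tc` makes the classical decoder correct on the preparation
failures. -/
theorem isUncorrelated {tc t : ℕ} (hR : R.CorrectsErrors tc) (ht : (t : ℤ) - 1 ≤ tc) (j : Fin m)
    (e : BVec n) : R.IsUncorrelated t j e := by
  refine ⟨min (Q.errorWeight a μ e) t, fun h => by omega, fun h => by omega, ?_⟩
  refine IsBigO.of_bound (2 * Fintype.card R.Failures) ?_
  have hlt : ∀ᶠ p : ℝ in 𝓝[>] 0, p < 1 := nhdsWithin_le_nhds (eventually_lt_nhds one_pos)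
  have hhalf : ∀ᶠ p : ℝ in 𝓝[>] 0, 1 / 2 < R.weight p 0 :=
    R.tendsto_weight_zero.eventually_const_lt (by norm_num)
  filter_upwards [hlt, hhalf, self_mem_nhdsWithin] with p h1 hw h0
  have h0' : 0 ≤ p := le_of_lt h0
  have hnum := prob_le_of_le_failureCount (R := R) h0' h1.le
    (S := {ω | Q.SameError a μ (R.residual ω j) e} ∩ R.accepted j)
    (s := min (Q.errorWeight a μ e) t) (by
      rintro ω ⟨hωe, hωa⟩
      by_cases hc : R.failureCount ω < t
      · have := errorWeight_le_failureCount hR (by omega) hωa.2 hωe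
        omega
      · omega)
  have hden : 1 / 2 ≤ R.prob p (R.accepted j) :=
    hw.le.trans (weight_le_prob h0' h1.le (zero_mem_accepted hR j))
  have hnn := R.prob_nonneg h0' h1.le ({ω | Q.SameError a μ (R.residual ω j) e} ∩ R.accepted j)
  have hpos : 0 < R.prob p (R.accepted j) := by linarith
  rw [condProb, Real.norm_of_nonneg (div_nonneg hnn hpos.le),
    Real.norm_of_nonneg (pow_nonneg h0' _), div_le_iff₀ hpos]
  have hb : 0 ≤ (Fintype.card R.Failures : ℝ) * p ^ min (Q.errorWeight a μ e) t := by positivity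
  nlinarith

end DistillationRound

theorem theorem3 :
    ∃ C : ℝ, 0 < C ∧
      ∀ (n rX rZ k : ℕ) (Q : CSSCode n rX rZ k) (a : Fin k → PauliType) (μ : PauliType)
        (ε : ℝ), Q.IsSparse a μ ε →
      ∀ t : ℕ, Q.CorrectsErrors t →
      ∀ (r m : ℕ) (R : DistillationRound Q a μ r m) (tc : ℕ), R.CorrectsErrors tc →
        (t : ℤ) - 1 ≤ (tc : ℤ) →
      ∀ (j : Fin m) (p : ℝ), 0 < p → p < 1 →
        1 - C * ε ≤ R.condProb p (R.qualified t j) (R.accepted j) := by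
  refine ⟨1, one_pos, ?_⟩
  intro n rX rZ k Q a μ ε hε t _ r m R tc hR ht j p h0 h1
  have hεpos : 0 < ε := by
    obtain ⟨ρ, _, hlt⟩ := hε
    exact lt_of_le_of_lt (by positivity) hlt
  have hq : R.qualified t j = Set.univ :=
    Set.eq_univ_of_forall fun ω => DistillationRound.isUncorrelated hR ht j _
  have hpos : 0 < R.prob p (R.accepted j) :=
    (R.weight_zero_pos h1).trans_le
      (DistillationRound.weight_le_prob h0.le h1.le (DistillationRound.zero_mem_accepted hR j))
  rw [DistillationRound.condProb, hq, Set.univ_inter, div_self hpos.ne']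
  linarith
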